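/- Let $\mathbb R\langle x\rangle$ be the ring of polynomials over $\mathbb R$ in $g$ freely noncommuting variables $x=(x_1,\dots,x_g)$, with the involution $*$ determined by $x_j^*=x_j$, $(pq)^*=q^*p^*$ and real linearity. Call $p$ symmetric if $p^*=p$. Let $\mathbb S_n$ be the set of real symmetric $n\times n$ matrices and $\mathbb S_n(\mathbb R^g)$ the set of $g$-tuples $X=(X_1,\dots,X_g)$ of such matrices; $p(X)$ denotes the matrix obtained by substituting $X_j$ for $x_j$, and $p(0)\in\mathbb R$ denotes the constant term of $p$. For $A\in\mathbb S_n$ put $$\mathcal D_p(A)=\{X\in\mathbb S_n(\mathbb R^g): A-p(X)\succ 0\}.$$ A linear polynomial is a real linear combination of $x_1,\dots,x_g$. A sum of squares is a polynomial of the form $\sum_{j=1}^m h_j^*h_j$ with $h_j\in\mathbb R\langle x\rangle$. A symmetric polynomial $q$ is quasi-convex if $q(0)=0$ and, for each $n$ and each positive definite $A\in\mathbb S_n$, the set $\mathcal D_q(A)$ is convex. A symmetric polynomial $q$ is matrix convex if $q(tX+(1-t)Y)\preceq t\,q(X)+(1-t)\,q(Y)$ for each $n$, all $X,Y\in\mathbb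 S_n(\mathbb R^g)$ and all $0\le t\le 1$. Theorem. For a symmetric polynomial $p\in\mathbb R\langle x\rangle$ the following are equivalent: (i) there are a linear polynomial $\ell$ and finitely many linear polynomials $s_j$ such that $p-p(0)=\ell+\sum_j s_j^*s_j$; (ii) $p$ is matrix convex; (iii) $\mathcal D_p(A)$ is convex for every $n$ and every $A\in\mathbb S_n$; (iv) $p-p(0)$ is quasi-convex and $p(0)-p$ is not a nonzero sum of squares. -/

import Mathlib

/-- Real polynomials in `g` freely noncommuting variables. Mathlib's `star` on this ring is the
involution that fixes the scalars and the variables and reverses products. -/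
abbrev FreePoly (g : ℕ) : Type := FreeAlgebra ℝ (Fin g)

namespace FreePoly

/-- Evaluation `p(X)` at a tuple of real `n × n` matrices: the algebra homomorphism `x_j ↦ X_j`. -/
noncomputable def eval {g n : ℕ} (p : FreePoly g) (X : Fin g → Matrix (Fin n) (Fin n) ℝ) :
    Matrix (Fin n) (Fin n) ℝ :=
  FreeAlgebra.lift ℝ X p

/-- The constant term of `p`, that is, its value at `0 ∈ ℝ^g` (the coefficient of the empty
word). -/
noncomputable def constTerm {g : ℕ} (p : FreePoly g) : ℝ :=
  FreeAlgebra.lift ℝ (0 : Fin g → ℝ) p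

/-- The polynomial `p - p(0)`. -/
noncomputable def centered {g : ℕ} (p : FreePoly g) : FreePoly g :=
  p - algebraMap ℝ (FreePoly g) (constTerm p)

/-- `p` is symmetric: `p* = p`. -/
def Symmetric {g : ℕ} (p : FreePoly g) : Prop :=
  star p = p

/-- `p` is linear (homogeneous of degree one, or zero): a linear combination of the variables. -/
def IsLinear {g : ℕ} (p : FreePoly g) : Prop :=
  p ∈ Submodule.span ℝ (Set.range (FreeAlgebra.ι ℝ : Fin g → FreePoly g))

/-- `p` is a hermitian sum of squares `∑ h_j* h_j` of free polynomials. -/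
def IsSumSq {g : ℕ} (p : FreePoly g) : Prop :=
  ∃ (m : ℕ) (h : Fin m → FreePoly g), p = ∑ j, star (h j) * h j

/-- `p = ℓ + ∑ s_j* s_j` with `ℓ` and all `s_j` linear. -/
def IsLinearPlusSumSqLinear {g : ℕ} (p : FreePoly g) : Prop :=
  ∃ (l : FreePoly g) (m : ℕ) (s : Fin m → FreePoly g),
    IsLinear l ∧ (∀ j, IsLinear (s j)) ∧ p = l + ∑ j, star (s j) * s j

/-- The set `𝒟(A)` of `g`-tuples `X` of symmetric `n × n` matrices with `A - p(X) ≻ 0`. -/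
def sublevel {g n : ℕ} (p : FreePoly g) (A : Matrix (Fin n) (Fin n) ℝ) :
    Set (Fin g → Matrix (Fin n) (Fin n) ℝ) :=
  {X | (∀ j, (X j).IsSymm) ∧ (A - eval p X).PosDef}

/-- `p` is quasi-convex: it is symmetric, `p(0) = 0`, and `𝒟(A)` is convex for every positive
definite `A` of every size. -/
def QuasiConvex {g : ℕ} (p : FreePoly g) : Prop :=
  Symmetric p ∧ constTerm p = 0 ∧
    ∀ (n : ℕ) (A : Matrix (Fin n) (Fin n) ℝ), A.PosDef → Convex ℝ (sublevel p A)

/-- `p` is matrix convex: it is symmetric and `p(tX + (1-t)Y) ⪯ t p(X) + (1-t) p(Y)` for all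
tuples of symmetric matrices `X`, `Y` of equal size and all `0 ≤ t ≤ 1`. -/
def MatrixConvex {g : ℕ} (p : FreePoly g) : Prop :=
  Symmetric p ∧
    ∀ (n : ℕ) (X Y : Fin g → Matrix (Fin n) (Fin n) ℝ) (t : ℝ),
      (∀ j, (X j).IsSymm) → (∀ j, (Y j).IsSymm) → 0 ≤ t → t ≤ 1 →
        (t • eval p X + (1 - t) • eval p Y - eval p (t • X + (1 - t) • Y)).PosSemidef

end FreePoly

/-! The substance is the passage from convex sublevel sets to squares of linear polynomials. In the
other direction, the convexity gap is linear in `p`, vanishes on affine terms, and equals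
t(1-t)(s(X)-s(Y))ᵀ(s(X)-s(Y)) on s*s for linear s.

Given X, Y, v with ⟨p(X)v,v⟩ and ⟨p(Y)v,v⟩ below a, choose A with ⟨Av,v⟩ = a and A huge on v⊥. Then
both tuples lie in 𝒟(A), so the strict sublevel sets of X ↦ ⟨p(X)v,v⟩ are midpoint convex
(`form_midpt_lt`). Comparing X ⊕ Y with Y ⊕ X upgrades this to midpoint convexity of the form itself
(`midpointConvex_of_level`). Quasi-convexity only reaches levels a > 0, but a direct summand on
which the form is positive lifts every level above 0 (`QuasiConvex.midpointConvex`). If the centered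
polynomial has no positive value, its negative is a sum of squares by Helton's theorem
(`isSumSq_of_form_nonneg`), and (iv) makes it zero.

Midpoint convexity is then tested to second order at X ⊕ 0 with an off-diagonal perturbation. A GNS
tuple makes the vectors w(X)u independent for words w up to the degree of p, so the perturbation can
realise any function t on nonempty words, and the second-order term is ∑ p_{a*b} t(a)t(b) ≥ 0
(`MidpointConvex.splitForm_nonneg`). A zero diagonal entry kills its row, which excludes words
longer than two; the words of length two then form a positive semidefinite matrix, that is, a sum of
squares of linear polynomials. -/

open Matrix

namespace FreePoly

/-! ### Words, coefficients and degree. -/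

/-- The basis of words. -/
noncomputable def wordBasis (g : ℕ) : Module.Basis (List (Fin g)) ℝ (FreePoly g) :=
  (FreeAlgebra.basisFreeMonoid ℝ (Fin g)).reindex FreeMonoid.toList

/-- The monomial of a word. -/
noncomputable def word {g : ℕ} (w : List (Fin g)) : FreePoly g :=
  (w.map (FreeAlgebra.ι ℝ)).prod

@[simp] theorem word_nil {g : ℕ} : word ([] : List (Fin g)) = 1 := rfl

@[simp] theorem word_cons {g : ℕ} (j : Fin g) (w : List (Fin g)) :
    word (j :: w) = FreeAlgebra.ι ℝ j * word w := by simp [word]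

theorem word_append {g : ℕ} (a b : List (Fin g)) : word (a ++ b) = word a * word b := by
  simp [word]

@[simp] theorem wordBasis_apply {g : ℕ} (w : List (Fin g)) : wordBasis g w = word w := by
  simp only [wordBasis, Module.Basis.reindex_apply, FreeAlgebra.basisFreeMonoid,
    Module.Basis.map_apply, Finsupp.coe_basisSingleOne]
  rw [LinearEquiv.symm_apply_eq, LinearEquiv.trans_apply, AlgEquiv.toLinearEquiv_apply]
  have h : FreeAlgebra.equivMonoidAlgebraFreeMonoid (word w)
      = MonoidAlgebra.of ℝ (FreeMonoid (Fin g)) (FreeMonoid.ofList w) := by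
    induction w with
    | nil => simp; rfl
    | cons j w ih =>
      rw [word_cons, map_mul, ih, FreeMonoid.ofList_cons, map_mul]
      simp [FreeAlgebra.equivMonoidAlgebraFreeMonoid]
  rw [h]
  rfl

theorem star_word {g : ℕ} (w : List (Fin g)) : star (word w) = word w.reverse := by
  induction w with
  | nil => simp
  | cons j w ih => simp [ih, word_append]

theorem star_smul_real {g : ℕ} (c : ℝ) (p : FreePoly g) : star (c • p) = c • star p := by
  rw [Algebra.smul_def, star_mul, FreeAlgebra.star_algebraMap, Algebra.smul_def,
    Algebra.commutes]

/-- The coefficient of the word `w`. -/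
noncomputable def coeff {g : ℕ} (w : List (Fin g)) : FreePoly g →ₗ[ℝ] ℝ := (wordBasis g).coord w

theorem coeff_word {g : ℕ} (u w : List (Fin g)) :
    coeff u (word w) = if u = w then 1 else 0 := by
  rw [← wordBasis_apply, coeff, Module.Basis.coord_apply, Module.Basis.repr_self,
    Finsupp.single_apply]
  simp [eq_comm]

theorem ext_coeff {g : ℕ} {p q : FreePoly g} (h : ∀ w, coeff w p = coeff w q) : p = q :=
  (wordBasis g).ext_elem h

/-- The words occurring in `p`. -/
noncomputable def support {g : ℕ} (p : FreePoly g) : Finset (List (Fin g)) :=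
  ((wordBasis g).repr p).support

theorem mem_support {g : ℕ} {p : FreePoly g} {w : List (Fin g)} :
    w ∈ support p ↔ coeff w p ≠ 0 := by
  simp [support, coeff]

theorem sum_support {g : ℕ} (p : FreePoly g) : ∑ w ∈ support p, coeff w p • word w = p := by
  conv_rhs => rw [← (wordBasis g).linearCombination_repr p]
  simp [Finsupp.linearCombination_apply, Finsupp.sum, support, coeff]

theorem word_induction {g : ℕ} {P : FreePoly g → Prop} (p : FreePoly g)
    (zero : P 0) (add : ∀ a b, P a → P b → P (a + b)) (smul : ∀ (c : ℝ) a, P a → P (c • a))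
    (word : ∀ w ∈ support p, P (word w)) : P p := by
  rw [← sum_support p]
  exact Finset.sum_induction _ P add zero fun w hw => smul _ _ (word w hw)

theorem coeff_star {g : ℕ} (w : List (Fin g)) (p : FreePoly g) :
    coeff w (star p) = coeff w.reverse p := by
  induction p using word_induction with
  | zero => simp
  | add a b ha hb => simp [ha, hb]
  | smul c a ha => simp [star_smul_real, ha]
  | word u _ =>
    rw [star_word, coeff_word, coeff_word]
    simp only [List.reverse_eq_iff]

/-- The polynomials of degree at most `N`. -/
noncomputable def degreeLE (g N : ℕ) : Submodule ℝ (FreePoly g) :=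
  Submodule.span ℝ (word '' {w | w.length ≤ N})

theorem word_mem_degreeLE {g N : ℕ} {w : List (Fin g)} (h : w.length ≤ N) :
    word w ∈ degreeLE g N := Submodule.subset_span ⟨w, h, rfl⟩

theorem one_mem_degreeLE {g N : ℕ} : (1 : FreePoly g) ∈ degreeLE g N :=
  word_mem_degreeLE (w := []) (by simp)

instance {g N : ℕ} : FiniteDimensional ℝ (degreeLE g N) :=
  FiniteDimensional.span_of_finite ℝ ((List.finite_length_le (Fin g) N).image _)

theorem length_le_of_mem_support {g N : ℕ} {p : FreePoly g} (hp : p ∈ degreeLE g N)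
    {w : List (Fin g)} (hw : w ∈ support p) : w.length ≤ N := by
  by_contra! hlt
  refine mem_support.1 hw ?_
  have : degreeLE g N ≤ LinearMap.ker (coeff w) := by
    rw [degreeLE, Submodule.span_le]
    rintro _ ⟨u, hu, rfl⟩
    simp only [SetLike.mem_coe, LinearMap.mem_ker, coeff_word]
    rw [if_neg]
    rintro rfl
    exact absurd hu (by simpa using hlt)
  exact this hp

theorem mem_degreeLE_iff {g N : ℕ} {p : FreePoly g} :
    p ∈ degreeLE g N ↔ ∀ w ∈ support p, w.length ≤ N := by
  refine ⟨fun hp w hw => length_le_of_mem_support hp hw, fun h => ?_⟩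
  rw [← sum_support p]
  exact Submodule.sum_mem _ fun w hw => Submodule.smul_mem _ _ (word_mem_degreeLE (h w hw))

theorem exists_mem_degreeLE {g : ℕ} (p : FreePoly g) : ∃ N, p ∈ degreeLE g N :=
  ⟨(support p).sup List.length, mem_degreeLE_iff.2 fun _ hw => Finset.le_sup hw⟩

/-! ### Evaluation, direct sums and quadratic forms. -/

/-- Evaluation at a tuple of matrices indexed by an arbitrary finite type. -/
noncomputable def evalAt {g : ℕ} {κ : Type} [Fintype κ] [DecidableEq κ]
    (X : Fin g → Matrix κ κ ℝ) : FreePoly g →ₐ[ℝ] Matrix κ κ ℝ :=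
  FreeAlgebra.lift ℝ X

theorem evalAt_ι {g : ℕ} {κ : Type} [Fintype κ] [DecidableEq κ]
    (X : Fin g → Matrix κ κ ℝ) (j : Fin g) : evalAt X (FreeAlgebra.ι ℝ j) = X j := by
  simp [evalAt]

theorem eval_eq_evalAt {g n : ℕ} (p : FreePoly g) (X : Fin g → Matrix (Fin n) (Fin n) ℝ) :
    eval p X = evalAt X p := rfl

theorem evalAt_star {g : ℕ} {κ : Type} [Fintype κ] [DecidableEq κ]
    {X : Fin g → Matrix κ κ ℝ} (hX : ∀ j, (X j).IsSymm) (p : FreePoly g) :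
    evalAt X (star p) = (evalAt X p)ᵀ := by
  induction p using FreeAlgebra.induction with
  | grade0 r =>
    rw [FreeAlgebra.star_algebraMap, AlgHom.commutes, Algebra.algebraMap_eq_smul_one,
      transpose_smul, transpose_one]
  | grade1 j => simpa [evalAt_ι] using (hX j).eq.symm
  | mul a b ha hb => simp [ha, hb]
  | add a b ha hb => simp [ha, hb]

theorem evalAt_isSymm {g : ℕ} {κ : Type} [Fintype κ] [DecidableEq κ]
    {X : Fin g → Matrix κ κ ℝ} (hX : ∀ j, (X j).IsSymm) {p : FreePoly g} (hp : Symmetric p) :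
    (evalAt X p).IsSymm := by
  rw [Matrix.IsSymm, ← evalAt_star hX, hp]

theorem evalAt_reindex {g : ℕ} {κ μ : Type} [Fintype κ] [DecidableEq κ] [Fintype μ]
    [DecidableEq μ] (e : κ ≃ μ) (X : Fin g → Matrix κ κ ℝ) (p : FreePoly g) :
    evalAt (fun j => (X j).submatrix e.symm e.symm) p = (evalAt X p).submatrix e.symm e.symm := by
  have : evalAt (fun j => (X j).submatrix e.symm e.symm)
      = (Matrix.reindexAlgEquiv ℝ ℝ e).toAlgHom.comp (evalAt X) := by
    apply FreeAlgebra.hom_ext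
    ext j : 1
    simp [evalAt_ι]
  rw [this]
  simp

theorem evalAt_fromBlocks {g : ℕ} {κ μ : Type} [Fintype κ] [DecidableEq κ] [Fintype μ]
    [DecidableEq μ] (X : Fin g → Matrix κ κ ℝ) (Y : Fin g → Matrix μ μ ℝ) (p : FreePoly g) :
    evalAt (fun j => fromBlocks (X j) 0 0 (Y j)) p
      = fromBlocks (evalAt X p) 0 0 (evalAt Y p) := by
  induction p using FreeAlgebra.induction with
  | grade0 r =>
    simp only [AlgHom.commutes]
    simp only [Algebra.algebraMap_eq_smul_one, ← fromBlocks_one, fromBlocks_smul, smul_zero]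
  | grade1 j => simp [evalAt_ι]
  | mul a b ha hb => simp [ha, hb, fromBlocks_multiply]
  | add a b ha hb => simp [ha, hb, fromBlocks_add]

/-- The quadratic form `⟨p(X) v, v⟩`. -/
noncomputable def form {g : ℕ} {κ : Type} [Fintype κ] [DecidableEq κ] (p : FreePoly g)
    (X : Fin g → Matrix κ κ ℝ) (v : κ → ℝ) : ℝ :=
  v ⬝ᵥ (evalAt X p *ᵥ v)

theorem form_reindex {g : ℕ} {κ μ : Type} [Fintype κ] [DecidableEq κ] [Fintype μ]
    [DecidableEq μ] (e : κ ≃ μ) (X : Fin g → Matrix κ κ ℝ) (p : FreePoly g) (v : κ → ℝ) :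
    form p (fun j => (X j).submatrix e.symm e.symm) (v ∘ e.symm) = form p X v := by
  rw [form, form, evalAt_reindex, submatrix_mulVec_equiv]
  simp only [Equiv.symm_symm, Function.comp_assoc, Equiv.symm_comp_self, Function.comp_id]
  exact Equiv.sum_comp e.symm (fun i => v i * (evalAt X p *ᵥ v) i)

theorem form_fromBlocks {g : ℕ} {κ μ : Type} [Fintype κ] [DecidableEq κ] [Fintype μ]
    [DecidableEq μ] (X : Fin g → Matrix κ κ ℝ) (Y : Fin g → Matrix μ μ ℝ) (p : FreePoly g)
    (v : κ → ℝ) (w : μ → ℝ) :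
    form p (fun j => fromBlocks (X j) 0 0 (Y j)) (Sum.elim v w) = form p X v + form p Y w := by
  rw [form, evalAt_fromBlocks, fromBlocks_mulVec]
  simp [form]

/-! ### Truncated GNS construction. -/

/-- Gelfand–Naimark–Segal construction for a functional that is positive definite on the
polynomials of degree at most `N`. -/
theorem exists_gns {g N : ℕ} (L : FreePoly g →ₗ[ℝ] ℝ) (hstar : ∀ p, L (star p) = L p)
    (hpos : ∀ h ∈ degreeLE g N, h ≠ 0 → 0 < L (star h * h)) :
    ∃ (n : ℕ) (X : Fin g → Matrix (Fin n) (Fin n) ℝ) (Φ : degreeLE g N ≃ₗ[ℝ] (Fin n → ℝ)),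
      (∀ j, (X j).IsSymm) ∧ (∀ a b, Φ a ⬝ᵥ Φ b = L (star (a : FreePoly g) * b)) ∧
      ∀ p : degreeLE g N, evalAt X (p : FreePoly g) *ᵥ Φ ⟨1, one_mem_degreeLE⟩ = Φ p := by
  -- Strict positivity gives a genuine inner product, so no quotient by null vectors is needed.
  let core : InnerProductSpace.Core ℝ (degreeLE g N) :=
    { inner := fun a b => L (star (a : FreePoly g) * b)
      conj_inner_symm := fun a b => by
        simp only [conj_trivial]
        rw [← hstar]; simp
      re_inner_nonneg := fun a => by
        simp only [RCLike.re_to_real]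
        by_cases h : (a : FreePoly g) = 0
        · simp [h]
        · exact (hpos a a.2 h).le
      add_left := fun a b c => by simp [add_mul]
      smul_left := fun a b c => by simp [star_smul_real]
      definite := fun a h => by
        by_contra hne
        have : (a : FreePoly g) ≠ 0 := fun h' => hne (Subtype.ext h')
        exact (hpos a a.2 this).ne' h }
  let _ : NormedAddCommGroup (degreeLE g N) := core.toNormedAddCommGroup
  let _ : InnerProductSpace ℝ (degreeLE g N) := InnerProductSpace.ofCore core.toCore
  have hinner : ∀ a b : degreeLE g N, inner ℝ a b = L (star (a : FreePoly g) * b) :=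
    fun _ _ => rfl
  let b := stdOrthonormalBasis ℝ (degreeLE g N)
  let Φ : degreeLE g N ≃ₗ[ℝ] (Fin _ → ℝ) :=
    b.repr.toLinearEquiv.trans (WithLp.linearEquiv 2 ℝ _)
  have hΦ : ∀ a i, Φ a i = L (star (b i : FreePoly g) * a) := fun a i => by
    rw [← hinner, ← b.repr_apply_apply]; rfl
  have hdot : ∀ a c, Φ a ⬝ᵥ Φ c = L (star (a : FreePoly g) * c) := fun a c => by
    rw [← hinner, ← b.sum_inner_mul_inner a c]
    refine Finset.sum_congr rfl fun i _ => ?_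
    rw [hΦ, hΦ, ← hinner, ← hinner, real_inner_comm]
  -- The compression of left multiplication by x_j to degree at most N. By `hX` it is exact as long
  -- as the product stays in that degree, which suffices to build every word of length at most N
  -- from 1.
  let X : Fin g → Matrix (Fin _) (Fin _) ℝ := fun j => Matrix.of fun i k =>
    L (star (b i : FreePoly g) * FreeAlgebra.ι ℝ j * (b k : FreePoly g))
  have hX : ∀ j, ∀ a c : degreeLE g N, (c : FreePoly g) = FreeAlgebra.ι ℝ j * (a : FreePoly g) →
      X j *ᵥ Φ a = Φ c := by
    intro j a c hc
    ext i
    have ha : (a : FreePoly g) = ∑ k, Φ a k • (b k : FreePoly g) := by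
      conv_lhs => rw [← b.sum_repr a]
      rw [Submodule.coe_sum]; rfl
    rw [hΦ, hc]
    conv_rhs => rw [ha]
    simp only [Finset.mul_sum, mul_smul_comm, map_sum, map_smul, smul_eq_mul]
    simp only [mulVec, dotProduct, X, Matrix.of_apply, mul_assoc]
    exact Finset.sum_congr rfl fun k _ => mul_comm _ _
  refine ⟨_, X, Φ, fun j => ?_, hdot, ?_⟩
  · ext i k
    rw [transpose_apply]
    simp only [X, Matrix.of_apply]
    rw [← hstar]
    simp [mul_assoc]
  · have hw : ∀ w : List (Fin g), ∀ h : w.length ≤ N,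
        evalAt X (word w) *ᵥ Φ ⟨1, one_mem_degreeLE⟩ = Φ ⟨word w, word_mem_degreeLE h⟩ := by
      intro w
      induction w with
      | nil => intro h; simp
      | cons j w ih =>
        intro h
        have h' : w.length ≤ N := by simp at h; omega
        have he : evalAt X (word (j :: w)) = X j * evalAt X (word w) := by
          rw [word_cons, map_mul, evalAt_ι]
        rw [he, ← mulVec_mulVec, ih h']
        exact hX j _ _ (word_cons j w)
    intro p
    have hp : p = ∑ w ∈ (support (p : FreePoly g)).attach, coeff w.1 (p : FreePoly g) •
        (⟨word w.1, word_mem_degreeLE (length_le_of_mem_support p.2 w.2)⟩ : degreeLE g N) := by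
      apply Subtype.ext
      rw [Submodule.coe_sum]
      conv_lhs => rw [← sum_support (p : FreePoly g), ← Finset.sum_attach]
      rfl
    conv_rhs => rw [hp]
    conv_lhs => rw [← sum_support (p : FreePoly g), ← Finset.sum_attach]
    simp only [map_sum, map_smul, sum_mulVec, smul_mulVec]
    exact Finset.sum_congr rfl fun w _ => by
      rw [hw w.1 (length_le_of_mem_support p.2 w.2)]

/-! ### The truncated Fock tuple and its faithful vacuum state. -/

/-- The adjacency matrices of the words of length at most `N`, labelled by the letter added on the
left. -/
noncomputable def fock (g N : ℕ) (j : Fin g) :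
    Matrix {w : List (Fin g) // w.length ≤ N} {w : List (Fin g) // w.length ≤ N} ℝ :=
  Matrix.of fun u w => (if u.1 = j :: w.1 then 1 else 0) + (if w.1 = j :: u.1 then 1 else 0)

theorem fock_isSymm {g N : ℕ} (j : Fin g) : (fock g N j).IsSymm := by
  ext u w
  simp [fock, add_comm]

noncomputable instance {g N : ℕ} : Fintype {w : List (Fin g) // w.length ≤ N} :=
  (List.finite_length_le (Fin g) N).fintype

/-- The indicator of the empty word. -/
def vacuum (g N : ℕ) : {w : List (Fin g) // w.length ≤ N} → ℝ :=
  fun u => if u.1 = [] then 1 else 0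

/-- Each letter lengthens or shortens a word by one, so from the empty word |w| steps reach length
|w| only by creating every letter of w, and never go beyond it. -/
theorem evalAt_fock_word {g N : ℕ} (w : List (Fin g)) (u : {w : List (Fin g) // w.length ≤ N})
    (h : w.length ≤ u.1.length) :
    (evalAt (fock g N) (word w) *ᵥ vacuum g N) u = if u.1 = w then 1 else 0 := by
  induction w generalizing u with
  | nil => simp [vacuum]
  | cons j w ih =>
    rw [word_cons, map_mul, ← mulVec_mulVec, evalAt_ι]
    set f := evalAt (fock g N) (word w) *ᵥ vacuum g N
    have key : ∀ v : {w : List (Fin g) // w.length ≤ N},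
        fock g N j u v * f v = if u.1 = j :: v.1 then (if v.1 = w then 1 else 0) else 0 := by
      intro v
      simp only [fock, Matrix.of_apply, add_mul, ite_mul, one_mul, zero_mul]
      have h2 : (if v.1 = j :: u.1 then f v else 0) = 0 := by
        split_ifs with hv
        · rw [ih v (by rw [hv]; simp at h ⊢; omega), if_neg]
          rintro rfl
          rw [hv] at h
          simp at h
        · rfl
      rw [h2, add_zero]
      split_ifs with h1 h3
      · rw [ih v (by rw [h1] at h; simpa using h), if_pos h3]
      · rw [ih v (by rw [h1] at h; simpa using h), if_neg h3]
      · rfl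
    simp only [mulVec, dotProduct, key]
    split_ifs with hu
    · have hw : w.length ≤ N := by
        have := u.2; rw [hu] at this; simp at this; omega
      rw [Finset.sum_eq_single ⟨w, hw⟩]
      · simp [hu]
      · rintro v - hv
        rw [hu]
        have : v.1 ≠ w := fun h' => hv (Subtype.ext h')
        simp [this]
      · simp
    · refine Finset.sum_eq_zero fun v _ => ?_
      split_ifs with h1 h3
      · rw [h3] at h1; exact absurd h1 hu
      · rfl
      · rfl

/-- At a longest word of h, the vector h(F)Ω has the coefficient of that word as its entry. -/
theorem evalAt_fock_vacuum_ne_zero {g N : ℕ} {h : FreePoly g} (hN : h ∈ degreeLE g N)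
    (h0 : h ≠ 0) : evalAt (fock g N) h *ᵥ vacuum g N ≠ 0 := by
  have hne : (support h).Nonempty := by
    rw [Finset.nonempty_iff_ne_empty]
    intro he
    exact h0 (by rw [← sum_support h, he, Finset.sum_empty])
  obtain ⟨w, hw, hmax⟩ := Finset.exists_max_image (support h) List.length hne
  have hwN := length_le_of_mem_support hN hw
  intro hz
  rw [← sum_support h] at hz
  have := congrFun hz ⟨w, hwN⟩
  simp only [map_sum, map_smul, sum_mulVec, smul_mulVec, Finset.sum_apply, Pi.smul_apply,
    Pi.zero_apply, smul_eq_mul] at this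
  rw [Finset.sum_eq_single w] at this
  · rw [evalAt_fock_word w ⟨w, hwN⟩ le_rfl, if_pos rfl, mul_one] at this
    exact mem_support.1 hw this
  · intro u hu huw
    rw [evalAt_fock_word u ⟨w, hwN⟩ (hmax u hu), if_neg (Ne.symm huw), mul_zero]
  · intro h; exact absurd hw h

/-- A vector state `p ↦ ⟨p(X) v, v⟩`. -/
noncomputable def vectorState {g : ℕ} {κ : Type} [Fintype κ] [DecidableEq κ]
    (X : Fin g → Matrix κ κ ℝ) (v : κ → ℝ) : FreePoly g →ₗ[ℝ] ℝ where
  toFun p := form p X v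
  map_add' p q := by simp [form, add_mulVec]
  map_smul' c p := by simp [form, smul_mulVec]

theorem vectorState_apply {g : ℕ} {κ : Type} [Fintype κ] [DecidableEq κ]
    (X : Fin g → Matrix κ κ ℝ) (v : κ → ℝ) (p : FreePoly g) :
    vectorState X v p = form p X v := rfl

theorem vectorState_star {g : ℕ} {κ : Type} [Fintype κ] [DecidableEq κ]
    {X : Fin g → Matrix κ κ ℝ} (hX : ∀ j, (X j).IsSymm) (v : κ → ℝ) (p : FreePoly g) :
    vectorState X v (star p) = vectorState X v p := by
  rw [vectorState_apply, vectorState_apply, form, form, evalAt_star hX, mulVec_transpose,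
    dotProduct_comm, ← dotProduct_mulVec]

theorem form_star_mul {g : ℕ} {κ : Type} [Fintype κ] [DecidableEq κ]
    {X : Fin g → Matrix κ κ ℝ} (hX : ∀ j, (X j).IsSymm) (v : κ → ℝ) (h k : FreePoly g) :
    form (star h * k) X v = (evalAt X h *ᵥ v) ⬝ᵥ (evalAt X k *ᵥ v) := by
  rw [form, map_mul, evalAt_star hX, ← mulVec_mulVec, dotProduct_mulVec, vecMul_transpose]

/-- The vacuum state on polynomials of degree at most `N`. -/
theorem exists_faithful (g N : ℕ) : ∃ L : FreePoly g →ₗ[ℝ] ℝ, (∀ p, L (star p) = L p) ∧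
    ∀ h ∈ degreeLE g N, h ≠ 0 → 0 < L (star h * h) := by
  refine ⟨vectorState (fock g N) (vacuum g N), vectorState_star fock_isSymm _, fun h hN h0 => ?_⟩
  rw [vectorState_apply, form_star_mul fock_isSymm]
  have := evalAt_fock_vacuum_ne_zero hN h0
  exact lt_of_le_of_ne (dotProduct_self_star_nonneg (R := ℝ) _) fun h' =>
    this (dotProduct_self_eq_zero.1 h'.symm)

/-! ### From convex sublevel sets to midpoint convex forms. -/

/-- A symmetric matrix that is positive at `v` becomes positive definite after adding a large
multiple of `‖v‖² - v vᵀ`. -/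
theorem exists_posDef_add_smul {n : ℕ} {B : Matrix (Fin n) (Fin n) ℝ} (hB : B.IsSymm)
    {v : Fin n → ℝ} (hv : 0 < v ⬝ᵥ (B *ᵥ v)) :
    ∃ M₀ : ℝ, ∀ M ≥ M₀, (B + M • ((v ⬝ᵥ v) • (1 : Matrix (Fin n) (Fin n) ℝ)
      - vecMulVec v v)).PosDef := by
  have hv0 : v ≠ 0 := by rintro rfl; simp at hv
  set b := v ⬝ᵥ (B *ᵥ v) with hb
  set s := v ⬝ᵥ v with hs
  have hs0 : 0 < s := lt_of_le_of_ne (dotProduct_self_star_nonneg (R := ℝ) v)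
    fun h => hv0 (dotProduct_self_eq_zero.1 h.symm)
  set C := ∑ i, ∑ j, |B i j| with hC
  set z := B *ᵥ v with hz
  have hlow : ∀ w : Fin n → ℝ, -(C * (w ⬝ᵥ w)) ≤ w ⬝ᵥ (B *ᵥ w) := by
    intro w
    have hw : ∀ i, w i ^ 2 ≤ w ⬝ᵥ w := fun i => by
      rw [pow_two]
      exact Finset.single_le_sum (f := fun i => w i * w i) (fun j _ => mul_self_nonneg _)
        (Finset.mem_univ i)
    simp only [hC, Finset.sum_mul, ← Finset.sum_neg_distrib]
    change _ ≤ ∑ i, w i * ∑ j, B i j * w j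
    refine Finset.sum_le_sum fun i _ => ?_
    rw [Finset.mul_sum]
    refine Finset.sum_le_sum fun j _ => ?_
    have h1 : |w i * w j| ≤ w ⬝ᵥ w := by
      rw [abs_mul]
      nlinarith [hw i, hw j, sq_abs (w i), sq_abs (w j), sq_nonneg (|w i| - |w j|)]
    have h2 : |w i * (B i j * w j)| ≤ |B i j| * (w ⬝ᵥ w) := by
      rw [show w i * (B i j * w j) = B i j * (w i * w j) by ring, abs_mul]
      exact mul_le_mul_of_nonneg_left h1 (abs_nonneg _)
    linarith [neg_abs_le (w i * (B i j * w j))]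
  -- On w ⊥ v the added term is M s |w|². Here C pays for ⟨Bw,w⟩, the 2/b term for the cross term
  -- 2c⟨w,z⟩ at the cost of half of b c², and 1 keeps the inequality strict.
  refine ⟨(C + (z ⬝ᵥ z) * (2 / b) + 1) / s, fun M hM => ?_⟩
  refine PosDef.of_dotProduct_mulVec_pos ?_ fun u hu => ?_
  · have h1 : (vecMulVec v v).IsSymm := by ext i j; simp [vecMulVec_apply, mul_comm]
    show _ᴴ = _
    rw [conjTranspose_eq_transpose_of_trivial]
    simp [hB.eq, h1.eq]
  · -- decompose along `v`
    set c := (v ⬝ᵥ u) / s with hc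
    set w := u - c • v with hw
    have hvw : v ⬝ᵥ w = 0 := by
      rw [hw, dotProduct_sub, dotProduct_smul, ← hs, smul_eq_mul, hc]; field_simp; ring
    have hu' : u = c • v + w := by rw [hw]; abel
    have hwv : w ⬝ᵥ v = 0 := by rw [dotProduct_comm, hvw]
    have hBw : v ⬝ᵥ (B *ᵥ w) = w ⬝ᵥ z := by
      rw [dotProduct_mulVec, ← mulVec_transpose, hB.eq, dotProduct_comm]
    have hval : star u ⬝ᵥ ((B + M • (s • (1 : Matrix (Fin n) (Fin n) ℝ) - vecMulVec v v)) *ᵥ u)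
        = c ^ 2 * b + 2 * c * (w ⬝ᵥ z) + w ⬝ᵥ (B *ᵥ w) + M * s * (w ⬝ᵥ w) := by
      have e1 : (vecMulVec v v) *ᵥ u = (v ⬝ᵥ u) • v := by
        rw [vecMulVec_mulVec]; ext i; simp [mul_comm]
      rw [star_trivial, add_mulVec, smul_mulVec, sub_mulVec, smul_mulVec, one_mulVec, e1]
      rw [hu']
      simp only [mulVec_add, mulVec_smul, dotProduct_add, add_dotProduct, smul_dotProduct,
        dotProduct_smul, dotProduct_sub, hvw, hwv, hBw, smul_eq_mul, ← hz, ← hs, ← hb]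
      ring
    rw [hval]
    have hww : 0 ≤ w ⬝ᵥ w := dotProduct_self_star_nonneg (R := ℝ) w
    have hcs : (w ⬝ᵥ z) ^ 2 ≤ (w ⬝ᵥ w) * (z ⬝ᵥ z) := by
      simpa [dotProduct, pow_two] using Finset.sum_mul_sq_le_sq_mul_sq Finset.univ w z
    have hMs : C + (z ⬝ᵥ z) * (2 / b) + 1 ≤ M * s := (div_le_iff₀ hs0).1 hM
    have hMw := mul_le_mul_of_nonneg_right hMs hww
    have hmix : -(b / 2 * c ^ 2) - 2 / b * ((w ⬝ᵥ w) * (z ⬝ᵥ z)) ≤ 2 * c * (w ⬝ᵥ z) := by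
      have h1 : 0 ≤ b / 2 * (c + 2 / b * (w ⬝ᵥ z)) ^ 2 := by positivity
      have h2 : b / 2 * (c + 2 / b * (w ⬝ᵥ z)) ^ 2
          = b / 2 * c ^ 2 + 2 * c * (w ⬝ᵥ z) + 2 / b * (w ⬝ᵥ z) ^ 2 := by
        field_simp; ring
      have h3 := mul_le_mul_of_nonneg_left hcs (by positivity : 0 ≤ 2 / b)
      linarith
    have hl := hlow w
    have hmain : b / 2 * c ^ 2 + w ⬝ᵥ w ≤
        c ^ 2 * b + 2 * c * (w ⬝ᵥ z) + w ⬝ᵥ (B *ᵥ w) + M * s * (w ⬝ᵥ w) := by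
      nlinarith
    refine lt_of_lt_of_le ?_ hmain
    by_cases hw0 : w = 0
    · have hc0 : c ≠ 0 := by
        rintro h
        exact hu (by rw [hu', hw0, h]; simp)
      have : 0 < c ^ 2 := by positivity
      positivity
    · have : 0 < w ⬝ᵥ w := lt_of_le_of_ne hww fun h => hw0 (dotProduct_self_eq_zero.1 h.symm)
      positivity

/-- The midpoint of two tuples. -/
noncomputable def midpt {g : ℕ} {κ : Type} (X Y : Fin g → Matrix κ κ ℝ) :
    Fin g → Matrix κ κ ℝ := fun j => (1 / 2 : ℝ) • (X j + Y j)

/-- Convexity of `𝒟(A)` for the positive definite `A` (or for all symmetric `A`) gives midpoint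
convexity of the positive (or all) strict sublevel sets of `X ↦ ⟨p(X) v, v⟩`. -/
theorem form_midpt_lt_fin {g n : ℕ} {p : FreePoly g} (hp : Symmetric p) {a : ℝ}
    (hconv : ∀ A : Matrix (Fin n) (Fin n) ℝ, A.IsSymm → (0 < a → A.PosDef) →
      Convex ℝ (sublevel p A))
    {X Y : Fin g → Matrix (Fin n) (Fin n) ℝ} (hX : ∀ j, (X j).IsSymm) (hY : ∀ j, (Y j).IsSymm)
    (v : Fin n → ℝ) (h1 : form p X v < a) (h2 : form p Y v < a) : form p (midpt X Y) v < a := by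
  by_cases hv0 : v = 0
  · subst hv0; simpa [form] using h1
  set s := v ⬝ᵥ v with hs
  have hs0 : 0 < s := lt_of_le_of_ne (dotProduct_self_star_nonneg (R := ℝ) v)
    fun h => hv0 (dotProduct_self_eq_zero.1 h.symm)
  -- Scaled so that ⟨Dv,v⟩ = a. Adding M • P leaves this value unchanged, since P v = 0.
  set D : Matrix (Fin n) (Fin n) ℝ := (a / s ^ 2) • vecMulVec v v with hD
  have hDs : D.IsSymm := by ext i j; simp [hD, vecMulVec_apply, mul_comm]
  have hDv : v ⬝ᵥ (D *ᵥ v) = a := by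
    have e1 : (vecMulVec v v) *ᵥ v = (v ⬝ᵥ v) • v := by
      rw [vecMulVec_mulVec]; ext i; simp [mul_comm]
    rw [hD, smul_mulVec, e1, dotProduct_smul, dotProduct_smul, ← hs, smul_eq_mul, smul_eq_mul]
    field_simp
  have hsub : ∀ {Z : Fin g → Matrix (Fin n) (Fin n) ℝ},
      v ⬝ᵥ ((D - evalAt Z p) *ᵥ v) = a - form p Z v := fun {Z} => by
    rw [sub_mulVec, dotProduct_sub, hDv, form]
  obtain ⟨M₁, hM₁⟩ := exists_posDef_add_smul (hDs.sub (evalAt_isSymm hX hp))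
    (v := v) (by rw [hsub]; linarith)
  obtain ⟨M₂, hM₂⟩ := exists_posDef_add_smul (hDs.sub (evalAt_isSymm hY hp))
    (v := v) (by rw [hsub]; linarith)
  set P : Matrix (Fin n) (Fin n) ℝ := (v ⬝ᵥ v) • 1 - vecMulVec v v with hP
  have hPs : P.IsSymm := by
    have h1 : (vecMulVec v v).IsSymm := by ext i j; simp [vecMulVec_apply, mul_comm]
    rw [Matrix.IsSymm]
    simp [hP, h1.eq]
  have hPv : P *ᵥ v = 0 := by
    rw [hP, sub_mulVec, smul_mulVec, one_mulVec, vecMulVec_mulVec]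
    ext i; simp [mul_comm]
  obtain ⟨M₃, hM₃⟩ : ∃ M₃ : ℝ, ∀ M ≥ M₃, 0 < a → (D + M • P).PosDef := by
    by_cases ha : 0 < a
    · obtain ⟨M₃, h⟩ := exists_posDef_add_smul hDs (v := v) (by rw [hDv]; exact ha)
      exact ⟨M₃, fun M hM _ => h M hM⟩
    · exact ⟨0, fun _ _ h => absurd h ha⟩
  set M := max M₁ (max M₂ M₃)
  have hc := hconv (D + M • P) (hDs.add (hPs.smul M)) (hM₃ M (by simp [M]))
  have mX : X ∈ sublevel p (D + M • P) := ⟨hX, by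
    rw [eval_eq_evalAt, add_sub_right_comm]; exact hM₁ M (by simp [M])⟩
  have mY : Y ∈ sublevel p (D + M • P) := ⟨hY, by
    rw [eval_eq_evalAt, add_sub_right_comm]; exact hM₂ M (by simp [M])⟩
  have mZ := hc mX mY (a := 1 / 2) (b := 1 / 2) (by norm_num) (by norm_num) (by norm_num)
  have hZ : (1 / 2 : ℝ) • X + (1 / 2 : ℝ) • Y = midpt X Y := by
    ext j : 1; simp [midpt]
  rw [hZ] at mZ
  have hpos := mZ.2.dotProduct_mulVec_pos hv0
  rw [star_trivial, eval_eq_evalAt, add_sub_right_comm, add_mulVec, smul_mulVec, hPv, smul_zero,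
    add_zero, hsub] at hpos
  linarith

theorem form_midpt_lt {g : ℕ} {p : FreePoly g} (hp : Symmetric p) {a : ℝ}
    (hconv : ∀ (n : ℕ) (A : Matrix (Fin n) (Fin n) ℝ), A.IsSymm → (0 < a → A.PosDef) →
      Convex ℝ (sublevel p A))
    {κ : Type} [Fintype κ] [DecidableEq κ]
    {X Y : Fin g → Matrix κ κ ℝ} (hX : ∀ j, (X j).IsSymm) (hY : ∀ j, (Y j).IsSymm)
    (v : κ → ℝ) (h1 : form p X v < a) (h2 : form p Y v < a) : form p (midpt X Y) v < a := by
  let e := Fintype.equivFin κ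
  rw [← form_reindex e] at h1 h2 ⊢
  exact form_midpt_lt_fin hp (hconv _) (fun j => (hX j).submatrix _) (fun j => (hY j).submatrix _)
    _ h1 h2

/-- Midpoint convexity of the forms of `p`. -/
def MidpointConvex {g : ℕ} (p : FreePoly g) : Prop :=
  ∀ {κ : Type} [Fintype κ] [DecidableEq κ] {X Y : Fin g → Matrix κ κ ℝ},
    (∀ j, (X j).IsSymm) → (∀ j, (Y j).IsSymm) → ∀ v : κ → ℝ,
      2 * form p (midpt X Y) v ≤ form p X v + form p Y v

theorem midpt_fromBlocks {g : ℕ} {κ μ : Type} (X Y : Fin g → Matrix κ κ ℝ)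
    (Z W : Fin g → Matrix μ μ ℝ) :
    midpt (fun j => fromBlocks (X j) 0 0 (Z j)) (fun j => fromBlocks (Y j) 0 0 (W j))
      = fun j => fromBlocks (midpt X Y j) 0 0 (midpt Z W j) := by
  ext j : 1
  simp [midpt, fromBlocks_add, fromBlocks_smul]

theorem midpt_self {g : ℕ} {κ : Type} (X : Fin g → Matrix κ κ ℝ) : midpt X X = X := by
  ext j : 1
  rw [midpt, ← two_smul ℝ (X j), smul_smul]; norm_num

theorem midpt_comm {g : ℕ} {κ : Type} (X Y : Fin g → Matrix κ κ ℝ) : midpt X Y = midpt Y X := by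
  ext j : 1
  rw [midpt, midpt, add_comm]

theorem isSymm_fromBlocks {κ μ : Type} {A : Matrix κ κ ℝ} {B : Matrix μ μ ℝ} (hA : A.IsSymm)
    (hB : B.IsSymm) : (fromBlocks A 0 0 B).IsSymm := by
  rw [Matrix.IsSymm, fromBlocks_transpose, hA.eq, hB.eq]; simp

/-- If all sublevel sets of the form of `p` are midpoint convex, then the form is: apply the
hypothesis to `X ⊕ Y` and `Y ⊕ X`. -/
theorem midpointConvex_of_level {g : ℕ} {p : FreePoly g}
    (h : ∀ {κ : Type} [Fintype κ] [DecidableEq κ] {X Y : Fin g → Matrix κ κ ℝ},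
      (∀ j, (X j).IsSymm) → (∀ j, (Y j).IsSymm) → ∀ (v : κ → ℝ) (a : ℝ),
      form p X v < a → form p Y v < a → form p (midpt X Y) v < a) : MidpointConvex p := by
  intro κ _ _ X Y hX hY v
  refine le_of_forall_gt fun a ha => ?_
  have := h (X := fun j => fromBlocks (X j) 0 0 (Y j)) (Y := fun j => fromBlocks (Y j) 0 0 (X j))
    (fun j => isSymm_fromBlocks (hX j) (hY j)) (fun j => isSymm_fromBlocks (hY j) (hX j))
    (Sum.elim v v) a (by rwa [form_fromBlocks]) (by rwa [form_fromBlocks, add_comm])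
  rw [midpt_fromBlocks, form_fromBlocks, midpt_comm Y X] at this
  linarith

theorem midpointConvex_of_sublevel {g : ℕ} {p : FreePoly g} (hp : Symmetric p)
    (h : ∀ (n : ℕ) (A : Matrix (Fin n) (Fin n) ℝ), A.IsSymm → Convex ℝ (sublevel p A)) :
    MidpointConvex p :=
  midpointConvex_of_level fun hX hY v _ h1 h2 =>
    form_midpt_lt hp (fun n A hA _ => h n A hA) hX hY v h1 h2

theorem form_smul {g : ℕ} {κ : Type} [Fintype κ] [DecidableEq κ] (p : FreePoly g)
    (X : Fin g → Matrix κ κ ℝ) (v : κ → ℝ) (c : ℝ) : form p X (c • v) = c ^ 2 * form p X v := by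
  simp only [form, mulVec_smul, dotProduct_smul, smul_dotProduct, smul_eq_mul]; ring

/-- A quasi-convex polynomial with a positive value somewhere is midpoint convex. -/
theorem QuasiConvex.midpointConvex {g : ℕ} {p : FreePoly g} (hp : QuasiConvex p)
    {μ : Type} [Fintype μ] [DecidableEq μ] {X₀ : Fin g → Matrix μ μ ℝ}
    (hX₀ : ∀ j, (X₀ j).IsSymm) {v₀ : μ → ℝ} (hv₀ : 0 < form p X₀ v₀) : MidpointConvex p := by
  refine midpointConvex_of_level fun {κ} _ _ {X Y} hX hY v a h1 h2 => ?_
  -- N makes the level a + N⟨p(X₀)v₀,v₀⟩ positive. Scaling v₀ by √N replaces N copies of the summand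
  -- X₀.
  obtain ⟨N, hN⟩ := exists_nat_gt (-a / form p X₀ v₀)
  rw [div_lt_iff₀ hv₀] at hN
  have hN2 : (Real.sqrt N) ^ 2 = N := Real.sq_sqrt N.cast_nonneg
  have := form_midpt_lt hp.1 (a := a + N * form p X₀ v₀)
    (fun n A _ hA => hp.2.2 n A (hA (by linarith)))
    (X := fun j => fromBlocks (X j) 0 0 (X₀ j)) (Y := fun j => fromBlocks (Y j) 0 0 (X₀ j))
    (fun j => isSymm_fromBlocks (hX j) (hX₀ j)) (fun j => isSymm_fromBlocks (hY j) (hX₀ j))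
    (Sum.elim v (Real.sqrt N • v₀))
    (by rw [form_fromBlocks, form_smul, hN2]; linarith)
    (by rw [form_fromBlocks, form_smul, hN2]; linarith)
  rw [midpt_fromBlocks, form_fromBlocks, midpt_self, form_smul, hN2] at this
  linarith

/-! ### Gram matrices and the Hankel form on nonempty words. -/

open scoped MatrixOrder ComplexOrder in
/-- A positive semidefinite Gram matrix gives a sum of squares. -/
theorem exists_sum_star_mul_of_posSemidef {g n : ℕ} {c : Matrix (Fin n) (Fin n) ℝ}
    (hc : c.PosSemidef) (e : Fin n → FreePoly g) :
    ∃ M : Matrix (Fin n) (Fin n) ℝ, ∑ i, ∑ j, c i j • (star (e i) * e j)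
      = ∑ k, star (∑ i, M k i • e i) * ∑ i, M k i • e i := by
  obtain ⟨M, hM⟩ := CStarAlgebra.nonneg_iff_eq_star_mul_self.1 hc.nonneg
  have hcM : ∀ i j, c i j = ∑ k, M k i * M k j := fun i j => by
    have := congrFun (congrFun hM i) j
    simpa [mul_apply, star_eq_conjTranspose] using this
  refine ⟨M, ?_⟩
  simp only [star_sum, star_smul_real, Finset.sum_mul_sum, smul_mul_smul_comm, hcM,
    Finset.sum_smul]
  rw [Finset.sum_congr rfl fun i _ => Finset.sum_comm, Finset.sum_comm]

/-- The sum of `s b * t (reverse a ++ m)` over the factorizations `w = a ++ b` with `a ≠ []`. -/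
def splitSum {g : ℕ} (s t : List (Fin g) → ℝ) : List (Fin g) → List (Fin g) → ℝ
  | [], _ => 0
  | j :: w, m => s w * t (j :: m) + splitSum s t w (j :: m)

theorem splitSum_add_left {g : ℕ} (s s' t : List (Fin g) → ℝ) (w m : List (Fin g)) :
    splitSum (s + s') t w m = splitSum s t w m + splitSum s' t w m := by
  induction w generalizing m with
  | nil => simp [splitSum]
  | cons j w ih => simp only [splitSum, ih, Pi.add_apply]; ring

theorem splitSum_add_right {g : ℕ} (s t t' : List (Fin g) → ℝ) (w m : List (Fin g)) :
    splitSum s (t + t') w m = splitSum s t w m + splitSum s t' w m := by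
  induction w generalizing m with
  | nil => simp [splitSum]
  | cons j w ih => simp only [splitSum, ih, Pi.add_apply]; ring

theorem splitSum_smul_left {g : ℕ} (c : ℝ) (s t : List (Fin g) → ℝ) (w m : List (Fin g)) :
    splitSum (c • s) t w m = c * splitSum s t w m := by
  induction w generalizing m with
  | nil => simp [splitSum]
  | cons j w ih => simp only [splitSum, ih, Pi.smul_apply, smul_eq_mul]; ring

theorem splitSum_smul_right {g : ℕ} (c : ℝ) (s t : List (Fin g) → ℝ) (w m : List (Fin g)) :
    splitSum s (c • t) w m = c * splitSum s t w m := by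
  induction w generalizing m with
  | nil => simp [splitSum]
  | cons j w ih => simp only [splitSum, ih, Pi.smul_apply, smul_eq_mul]; ring

/-- The argument m holds the reversed letters already passed, so the only possible cut is the one
where the accumulated prefix is a; the length condition says that this cut is still ahead. -/
theorem splitSum_single {g : ℕ} (a b w m : List (Fin g)) :
    splitSum (Pi.single b 1) (Pi.single a 1) w m
      = if a.reverse ++ b = m.reverse ++ w ∧ m.length < a.length then 1 else 0 := by
  induction w generalizing m with
  | nil =>
    rw [splitSum, if_neg]
    rintro ⟨h, hlt⟩
    have := congrArg List.length h
    simp at this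
    omega
  | cons j w ih =>
    have hrev : (j :: m).reverse ++ w = m.reverse ++ j :: w := by simp
    rw [splitSum, ih, hrev]
    by_cases hA : a.reverse ++ b = m.reverse ++ j :: w
    · by_cases hl : a.length = m.length + 1
      · obtain ⟨h1, h2⟩ := List.append_inj (hA.trans hrev.symm) (by simp [hl])
        have h1' : a = j :: m := List.reverse_injective h1
        subst h1' h2
        simp
      · have hne : j :: m ≠ a := by rintro rfl; simp at hl
        simp only [Pi.single_eq_of_ne hne, mul_zero, zero_add, hA, true_and, List.length_cons]
        congr 1
        exact propext ⟨fun h => by omega, fun h => by omega⟩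
    · have hne : ¬ (w = b ∧ j :: m = a) := by
        rintro ⟨rfl, rfl⟩
        exact hA hrev
      simp only [hA, false_and, if_false, add_zero]
      by_cases hw : w = b
      · rw [Pi.single_eq_of_ne (fun h => hne ⟨hw, h⟩), mul_zero]
      · rw [Pi.single_eq_of_ne hw, zero_mul]

/-- The bilinear form `(s, t) ↦ ∑ p_{a* b} t(a) s(b)`, over the nonempty words `a`. -/
noncomputable def splitForm {g : ℕ} (s t : List (Fin g) → ℝ) : FreePoly g →ₗ[ℝ] ℝ :=
  (wordBasis g).constr ℝ fun w => splitSum s t w []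

theorem splitForm_word {g : ℕ} (s t : List (Fin g) → ℝ) (w : List (Fin g)) :
    splitForm s t (word w) = splitSum s t w [] := by
  rw [← wordBasis_apply, splitForm, Module.Basis.constr_basis]

theorem splitForm_single {g : ℕ} {a : List (Fin g)} (ha : a ≠ []) (b : List (Fin g)) :
    splitForm (Pi.single b 1) (Pi.single a 1) = coeff (a.reverse ++ b) := by
  refine (wordBasis g).ext fun w => ?_
  rw [wordBasis_apply, splitForm_word, splitSum_single, coeff_word]
  simp [List.length_pos_iff, ha]

theorem splitForm_add_smul {g : ℕ} (s t : List (Fin g) → ℝ) (c : ℝ) (p : FreePoly g) :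
    splitForm (s + c • t) (s + c • t) p = splitForm s s p
      + c * (splitForm s t p + splitForm t s p) + c ^ 2 * splitForm t t p := by
  induction p using word_induction with
  | zero => simp
  | add a b ha hb => simp only [map_add, ha, hb]; ring
  | smul r a ha => simp only [map_smul, ha, smul_eq_mul]; ring
  | word w _ =>
    simp only [splitForm_word, splitSum_add_left, splitSum_add_right, splitSum_smul_left,
      splitSum_smul_right]
    ring

/-! ### Second-order perturbation of a bordered tuple. -/

/-- The tuple `X ⊕ 0` on `ℝⁿ ⊕ ℝ` perturbed by the off-diagonal vectors `ε T`. -/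
noncomputable def bordered {g n : ℕ} (X : Fin g → Matrix (Fin n) (Fin n) ℝ)
    (T : Fin g → Fin n → ℝ) (ε : ℝ) (j : Fin g) : Matrix (Fin n ⊕ Unit) (Fin n ⊕ Unit) ℝ :=
  fromBlocks (X j) (Matrix.of fun i _ => ε * T j i) (Matrix.of fun _ i => ε * T j i) 0

theorem bordered_isSymm {g n : ℕ} {X : Fin g → Matrix (Fin n) (Fin n) ℝ}
    (hX : ∀ j, (X j).IsSymm) (T : Fin g → Fin n → ℝ) (ε : ℝ) (j : Fin g) :
    (bordered X T ε j).IsSymm := by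
  rw [Matrix.IsSymm, bordered, fromBlocks_transpose, (hX j).eq]
  rfl

theorem midpt_bordered {g n : ℕ} (X : Fin g → Matrix (Fin n) (Fin n) ℝ)
    (T : Fin g → Fin n → ℝ) (ε : ℝ) :
    midpt (bordered X T ε) (bordered X T (-ε)) = bordered X T 0 := by
  ext j a b
  rcases a with a | a <;> rcases b with b | b <;> (simp [midpt, bordered]; try ring)

theorem bordered_mulVec {g n : ℕ} (X : Fin g → Matrix (Fin n) (Fin n) ℝ)
    (T : Fin g → Fin n → ℝ) (ε : ℝ) (j : Fin g) (x : Fin n → ℝ) (y : ℝ) :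
    bordered X T ε j *ᵥ Sum.elim x (fun _ => y)
      = Sum.elim (X j *ᵥ x + (ε * y) • T j) (fun _ => ε * (T j ⬝ᵥ x)) := by
  rw [bordered, fromBlocks_mulVec]
  simp only [Sum.elim_comp_inl, Sum.elim_comp_inr, zero_mulVec, add_zero]
  congr 1
  · ext i
    simp [mulVec, dotProduct]
    ring
  · ext i
    simp [mulVec, dotProduct, Finset.mul_sum, mul_assoc]

/-- Second-order expansion in `ε` of a word at the bordered tuple. -/
theorem bordered_word_expansion {g n N : ℕ} {X : Fin g → Matrix (Fin n) (Fin n) ℝ}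
    (hX : ∀ j, (X j).IsSymm) {T : Fin g → Fin n → ℝ} {t : List (Fin g) → ℝ} (ht : t [] = 0)
    {u : List (Fin g) → Fin n → ℝ}
    (hXu : ∀ j w, w.length < N → X j *ᵥ u w = u (j :: w))
    (hTu : ∀ j w, w.length ≤ N → T j ⬝ᵥ u w = t (j :: w)) (w : List (Fin g))
    (hw : w.length ≤ N) :
    ∃ (c : Fin n → ℝ) (r : ℝ → Fin n → ℝ) (s : ℝ → ℝ), Continuous r ∧ Continuous s ∧
      (∀ m : List (Fin g), w.length + m.length ≤ N → c ⬝ᵥ u m = splitSum t t w m) ∧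
      ∀ ε, evalAt (bordered X T ε) (word w) *ᵥ Sum.elim (u []) (fun _ => 0)
        = Sum.elim (u w + ε ^ 2 • c + ε ^ 3 • r ε) (fun _ => ε * t w + ε ^ 2 * s ε) := by
  induction w with
  | nil =>
    refine ⟨0, 0, 0, continuous_const, continuous_const, fun m _ => by simp [splitSum],
      fun ε => by simp [ht]⟩
  | cons j w ih =>
    simp only [List.length_cons] at hw
    obtain ⟨c, r, s, hr, hs, hc, he⟩ := ih (by omega)
    -- A second-order contribution either has already returned to ℝⁿ and is moved by X_j, or returns
    -- now along T_j from the extra coordinate, reached with amplitude ε t(w). This is the recursion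
    -- of `splitSum`.
    refine ⟨X j *ᵥ c + t w • T j, fun ε => X j *ᵥ r ε + s ε • T j,
      fun ε => ε * (T j ⬝ᵥ c) + ε ^ 2 * (T j ⬝ᵥ r ε), ?_, ?_, fun m hm => ?_, fun ε => ?_⟩
    · exact (Continuous.matrix_mulVec continuous_const hr).add (hs.smul continuous_const)
    · exact (continuous_id.mul continuous_const).add
        ((continuous_id.pow 2).mul (Continuous.dotProduct continuous_const hr))
    · simp only [List.length_cons] at hm
      rw [add_dotProduct, smul_dotProduct, hTu j m (by omega), splitSum,
        ← hc (j :: m) (by simp; omega), ← hXu j m (by omega), smul_eq_mul, add_comm]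
      congr 1
      rw [dotProduct_mulVec, ← mulVec_transpose, (hX j).eq]
    · have hmul : evalAt (bordered X T ε) (word (j :: w))
          = bordered X T ε j * evalAt (bordered X T ε) (word w) := by
        rw [word_cons, map_mul, evalAt_ι]
      rw [hmul, ← mulVec_mulVec, he, bordered_mulVec]
      congr 1
      · rw [mulVec_add, mulVec_add, mulVec_smul, mulVec_smul, hXu j w (by omega)]
        ext i
        simp only [Pi.add_apply, Pi.smul_apply, smul_eq_mul]
        ring
      · ext
        rw [dotProduct_add, dotProduct_add, dotProduct_smul, dotProduct_smul,
          hTu j w (by omega), smul_eq_mul, smul_eq_mul]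
        ring

theorem nonneg_of_expansion {C : ℝ} {R : ℝ → ℝ} (hR : Continuous R)
    (h : ∀ ε : ℝ, 0 ≤ ε ^ 2 * C + ε ^ 3 * R ε) : 0 ≤ C := by
  have ht : Filter.Tendsto (fun ε : ℝ => C + ε * R ε) (nhdsWithin 0 (Set.Ioi 0)) (nhds C) := by
    have : Continuous fun ε : ℝ => C + ε * R ε := by fun_prop
    simpa using (this.tendsto 0).mono_left nhdsWithin_le_nhds
  refine ge_of_tendsto ht ?_
  filter_upwards [self_mem_nhdsWithin] with ε hε
  have hε : 0 < ε := hε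
  have h1 := h ε
  rw [show ε ^ 2 * C + ε ^ 3 * R ε = ε ^ 2 * (C + ε * R ε) by ring] at h1
  exact nonneg_of_mul_nonneg_right h1 (by positivity)

/-- The Hankel form of a midpoint convex polynomial, restricted to nonempty words, is positive. -/
theorem MidpointConvex.splitForm_nonneg {g : ℕ} {p : FreePoly g} (hp : MidpointConvex p)
    {t : List (Fin g) → ℝ} (ht : t [] = 0) : 0 ≤ splitForm t t p := by
  obtain ⟨N, hN⟩ := exists_mem_degreeLE p
  obtain ⟨L, hL, hLpos⟩ := exists_faithful g N
  obtain ⟨n, X, Φ, hX, -, hΦ⟩ := exists_gns L hL hLpos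
  set u : List (Fin g) → Fin n → ℝ := fun w =>
    evalAt X (word w) *ᵥ Φ ⟨1, one_mem_degreeLE⟩ with hu
  have huΦ : ∀ w (h : w.length ≤ N), u w = Φ ⟨word w, word_mem_degreeLE h⟩ :=
    fun w h => hΦ ⟨word w, word_mem_degreeLE h⟩
  let lam : Fin g → FreePoly g →ₗ[ℝ] ℝ := fun j => (wordBasis g).constr ℝ fun w => t (j :: w)
  -- `Φ` is an isomorphism, so the functional `lam j` on degree at most N is represented by a
  -- vector, and ⟨T_j, u_w⟩ = t(jw) can be prescribed freely.
  let T : Fin g → Fin n → ℝ := fun j i => lam j (Φ.symm (Pi.single i 1) : degreeLE g N)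
  have hXu : ∀ j w, w.length < N → X j *ᵥ u w = u (j :: w) := fun j w _ => by
    simp only [hu, word_cons, map_mul, evalAt_ι, mulVec_mulVec]
  have hTu : ∀ j w, w.length ≤ N → T j ⬝ᵥ u w = t (j :: w) := fun j w h => by
    have h1 : ∀ a : degreeLE g N, T j ⬝ᵥ Φ a = lam j (a : FreePoly g) := fun a => by
      have ha : a = ∑ i, Φ a i • Φ.symm (Pi.single i 1) := by
        apply Φ.injective
        simp only [map_sum, map_smul, LinearEquiv.apply_symm_apply]
        exact pi_eq_sum_univ' (Φ a)
      conv_rhs => rw [ha]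
      rw [Submodule.coe_sum, map_sum]
      simp only [Submodule.coe_smul, map_smul, smul_eq_mul]
      exact Finset.sum_congr rfl fun i _ => mul_comm _ _
    rw [huΦ w h, h1]
    simp only [lam]
    rw [← wordBasis_apply, Module.Basis.constr_basis]
  have hexp := fun w : support p =>
    bordered_word_expansion hX ht hXu hTu w.1 (length_le_of_mem_support hN w.2)
  choose c r s hr hs hc he using hexp
  set v : Fin n ⊕ Unit → ℝ := Sum.elim (u []) (fun _ => 0) with hv
  set R : ℝ → ℝ := fun ε => ∑ w : support p, coeff w.1 p * (u [] ⬝ᵥ r w ε) with hR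
  have hRc : Continuous R := continuous_finsetSum _ fun w _ =>
    continuous_const.mul (Continuous.dotProduct continuous_const (hr w))
  have hform : ∀ ε, form p (bordered X T ε) v
      = (∑ w : support p, coeff w.1 p * (u [] ⬝ᵥ u w.1)) + ε ^ 2 * splitForm t t p
        + ε ^ 3 * R ε := by
    intro ε
    have hps : ∀ f : FreePoly g →ₗ[ℝ] ℝ,
        f p = ∑ w : support p, coeff w.1 p * f (word w.1) := fun f => by
      conv_lhs => rw [← sum_support p]
      rw [map_sum, ← Finset.sum_coe_sort]
      simp
    rw [← vectorState_apply, hps (vectorState _ _), hps (splitForm t t), hR, Finset.mul_sum,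
      Finset.mul_sum, ← Finset.sum_add_distrib, ← Finset.sum_add_distrib]
    refine Finset.sum_congr rfl fun w _ => ?_
    rw [vectorState_apply, form, he w ε, splitForm_word,
      ← hc w [] (by simpa using length_le_of_mem_support hN w.2), hv]
    rw [sumElim_dotProduct_sumElim, dotProduct_add, dotProduct_add, dotProduct_smul,
      dotProduct_smul, dotProduct_comm (c w) (u [])]
    simp only [smul_eq_mul, dotProduct, zero_mul, Finset.sum_const_zero, add_zero]
    ring
  have hRneg : Continuous fun ε => R ε - R (-ε) := hRc.sub (hRc.comp continuous_neg)
  -- The tuples for ε and -ε have the unperturbed tuple as midpoint, so the zeroth-order terms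
  -- cancel.
  have h2 : 0 ≤ 2 * splitForm t t p := nonneg_of_expansion hRneg fun ε => by
    have := hp (bordered_isSymm hX T ε) (bordered_isSymm hX T (-ε)) v
    rw [midpt_bordered, hform, hform, hform] at this
    linarith
  linarith

/-! ### Degree at most two, and the sum of squares. -/

/-- For a longest word ib with |b| ≥ 2, the word b*b is longer still, so the Hankel form has
diagonal entry 0 at b; nonnegativity then forces the off-diagonal entry at (i, b) to vanish. -/
theorem MidpointConvex.length_le_two {g : ℕ} {p : FreePoly g} (hs : Symmetric p)
    (hp : MidpointConvex p) {w : List (Fin g)} (hw : w ∈ support p) : w.length ≤ 2 := by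
  obtain ⟨w₀, hw₀, hmax⟩ := Finset.exists_max_image (support p) List.length ⟨w, hw⟩
  refine (hmax w hw).trans ?_
  by_contra! hlt
  match w₀, hw₀, hlt, hmax with
  | i :: b, hw₀, hlt, hmax =>
    simp only [List.length_cons] at hlt hmax
    have hb : b ≠ [] := by rintro rfl; simp at hlt
    have hbb : coeff (b.reverse ++ b) p = 0 := by
      by_contra h
      have := hmax _ (mem_support.2 h)
      simp at this
      omega
    have hsym : coeff (b.reverse ++ [i]) p = coeff (i :: b) p := by
      conv_rhs => rw [← hs, coeff_star]
      simp
    have hq : ∀ β : ℝ, 0 ≤ coeff [i, i] p + β * (2 * coeff (i :: b) p) := fun β => by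
      have := hp.splitForm_nonneg (t := Pi.single [i] 1 + β • Pi.single b 1)
        (by simp [hb.symm])
      rw [splitForm_add_smul, splitForm_single (List.cons_ne_nil _ _), splitForm_single hb,
        splitForm_single (List.cons_ne_nil _ _), splitForm_single hb, hbb, hsym] at this
      simp only [List.reverse_cons, List.reverse_nil, List.nil_append, List.cons_append] at this
      linarith
    have hne := mem_support.1 hw₀
    -- This β makes the right-hand side equal to -1.
    have := hq (-(coeff [i, i] p + 1) / (2 * coeff (i :: b) p))
    rw [div_mul_cancel₀ _ (by simpa using hne)] at this
    linarith

theorem coeff_nil {g : ℕ} (p : FreePoly g) : coeff [] p = constTerm p := by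
  induction p using word_induction with
  | zero => simp [constTerm]
  | add a b ha hb => simp only [constTerm, map_add] at ha hb ⊢; rw [ha, hb]
  | smul c a ha => simp only [constTerm, map_smul] at ha ⊢; rw [ha]
  | word w _ =>
    cases w with
    | nil => rw [coeff_word, word_nil]; simp [constTerm]
    | cons j w => rw [coeff_word, word_cons]; simp [constTerm]

theorem eq_linear_add_quadratic {g : ℕ} {p : FreePoly g} (h0 : constTerm p = 0)
    (h2 : ∀ w ∈ support p, w.length ≤ 2) :
    p = ∑ i, coeff [i] p • word [i] + ∑ i, ∑ j, coeff [i, j] p • word [i, j] := by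
  refine ext_coeff fun w => ?_
  simp only [map_add, map_sum, map_smul, coeff_word, smul_eq_mul]
  match w with
  | [] => simp [coeff_nil, h0]
  | [k] => simp
  | [k, l] =>
    simp only [List.cons.injEq, and_true, reduceCtorEq, and_false, if_false, mul_zero,
      Finset.sum_const_zero, zero_add, mul_ite, mul_one]
    rw [Finset.sum_eq_single k, Finset.sum_eq_single l]
    · simp
    · rintro j - hj; simp [hj.symm]
    · simp
    · rintro i - hi; simp [hi.symm]
    · simp
  | a :: b :: c :: w =>
    have : coeff (a :: b :: c :: w) p = 0 := by
      by_contra h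
      have := h2 _ (mem_support.2 h)
      simp at this
    simp [this]

theorem MidpointConvex.isLinearPlusSumSqLinear {g : ℕ} {p : FreePoly g} (hs : Symmetric p)
    (h0 : constTerm p = 0) (hp : MidpointConvex p) : IsLinearPlusSumSqLinear p := by
  have hdec := eq_linear_add_quadratic h0 fun w hw => hp.length_le_two hs hw
  let c : Matrix (Fin g) (Fin g) ℝ := Matrix.of fun i j => coeff [i, j] p
  have hc : c.PosSemidef := by
    refine PosSemidef.of_dotProduct_mulVec_nonneg ?_ fun u => ?_
    · ext i j
      simp only [conjTranspose_apply, star_trivial, c, Matrix.of_apply]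
      conv_lhs => rw [← hs, coeff_star]
      rfl
    -- Supported on single letters, so that only words of length two contribute.
    · let t : List (Fin g) → ℝ := fun w => match w with
        | [i] => u i
        | _ => 0
      have h := hp.splitForm_nonneg (t := t) rfl
      rw [hdec] at h
      simp only [map_add, map_sum, map_smul, splitForm_word, splitSum, t, smul_eq_mul, mul_zero,
        zero_mul, add_zero, zero_add, Finset.sum_const_zero] at h
      simp only [star_trivial, mulVec, dotProduct, c, Matrix.of_apply, Finset.mul_sum]
      refine h.trans_eq (Finset.sum_congr rfl fun i _ => Finset.sum_congr rfl fun j _ => ?_)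
      ring
  obtain ⟨M, hM⟩ := exists_sum_star_mul_of_posSemidef hc fun i => (word [i] : FreePoly g)
  have hlin : ∀ a : Fin g → ℝ, IsLinear (∑ i, a i • (word [i] : FreePoly g)) := fun a =>
    Submodule.sum_mem _ fun i _ => Submodule.smul_mem _ _
      (Submodule.subset_span ⟨i, by simp⟩)
  refine ⟨∑ i, coeff [i] p • word [i], g, fun k => ∑ i, M k i • word [i],
    hlin fun i => coeff [i] p, fun k => hlin _, ?_⟩
  conv_lhs => rw [hdec]
  rw [← hM]
  simp [c]

/-! ### Helton's theorem by separation and GNS. -/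

/-- The density matrices form a compact set. -/
theorem isCompact_posSemidef_trace_one (n : ℕ) :
    IsCompact {G : Matrix (Fin n) (Fin n) ℝ | G.PosSemidef ∧ G.trace = 1} := by
  have hbox : IsCompact ((Set.univ : Set (Fin n)).pi fun _ =>
      (Set.univ : Set (Fin n)).pi fun _ => Set.Icc (-1 : ℝ) 1) :=
    isCompact_univ_pi fun _ => isCompact_univ_pi fun _ => isCompact_Icc
  have hclosed : IsClosed {G : Matrix (Fin n) (Fin n) ℝ | G.PosSemidef ∧ G.trace = 1} := by
    have : {G : Matrix (Fin n) (Fin n) ℝ | G.PosSemidef ∧ G.trace = 1}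
        = {G | Gᴴ = G} ∩ (⋂ x : Fin n → ℝ, {G | 0 ≤ star x ⬝ᵥ (G *ᵥ x)}) ∩ {G | G.trace = 1} := by
      ext G
      simp only [posSemidef_iff_dotProduct_mulVec, Matrix.IsHermitian, Set.mem_inter_iff,
        Set.mem_iInter, Set.mem_ofPred_eq]
    rw [this]
    refine ((isClosed_eq (by fun_prop) (by fun_prop)).inter (isClosed_iInter fun x =>
      isClosed_le continuous_const ?_)).inter (isClosed_eq (by fun_prop) continuous_const)
    exact Continuous.dotProduct continuous_const
      (Continuous.matrix_mulVec continuous_id continuous_const)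
  refine hbox.of_isClosed_subset hclosed ?_
  suffices hb : ∀ G : Matrix (Fin n) (Fin n) ℝ, G.PosSemidef → G.trace = 1 →
      ∀ i j, G i j ∈ Set.Icc (-1 : ℝ) 1 from fun G hG i _ j _ => hb G hG.1 hG.2 i j
  intro G hG htr i j
  have hd : ∀ k, 0 ≤ G k k ∧ G k k ≤ 1 := fun k => ⟨hG.diag_nonneg, by
    rw [← htr]
    exact Finset.single_le_sum (f := fun k => G k k) (fun l _ => hG.diag_nonneg)
      (Finset.mem_univ k)⟩
  have hsym : G j i = G i j := by simpa using hG.1.apply i j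
  have hval : ∀ c : ℝ, 0 ≤ G i i + 2 * c * G i j + c ^ 2 * G j j := fun c => by
    have := hG.dotProduct_mulVec_nonneg (Pi.single i 1 + c • Pi.single j 1)
    simp only [star_trivial, mulVec_add, mulVec_smul, dotProduct_add, add_dotProduct,
      smul_dotProduct, dotProduct_smul, mulVec_single_one, single_one_dotProduct,
      Matrix.col_apply, smul_eq_mul, hsym] at this
    linarith
  have h1 := hval 1
  have h2 := hval (-1)
  constructor <;> linarith [hd i, hd j]

/-- The involution as a linear map. -/
noncomputable def starLinear (g : ℕ) : FreePoly g →ₗ[ℝ] FreePoly g where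
  toFun := star
  map_add' := star_add
  map_smul' := star_smul_real

/-- **Helton's theorem**: a symmetric free polynomial that is positive semidefinite at all tuples of
symmetric matrices is a sum of squares. -/
theorem isSumSq_of_form_nonneg {g : ℕ} {p : FreePoly g} (hs : Symmetric p)
    (h : ∀ (n : ℕ) (X : Fin g → Matrix (Fin n) (Fin n) ℝ) (v : Fin n → ℝ),
      (∀ j, (X j).IsSymm) → 0 ≤ form p X v) : IsSumSq p := by
  by_contra hnot
  obtain ⟨N, hN⟩ := exists_mem_degreeLE p
  obtain ⟨L₀, hL₀, hL₀pos⟩ := exists_faithful g N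
  obtain ⟨n, X, Φ, hX, hdot, hΦ⟩ := exists_gns L₀ hL₀ hL₀pos
  -- If L₀ p were 0, positivity of p(X) would give p(X)Φ(1) = 0, that is Φ(p) = 0, so p = 0.
  have hL₀p : 0 < L₀ p := by
    have h1 : L₀ p = form p X (Φ ⟨1, one_mem_degreeLE⟩) := by
      rw [form, hΦ ⟨p, hN⟩, hdot]; simp
    refine lt_of_le_of_ne (h1 ▸ h n X _ hX) fun h0 => hnot ?_
    have hpsd : (evalAt X p).PosSemidef := PosSemidef.of_dotProduct_mulVec_nonneg
      (by rw [Matrix.IsHermitian, conjTranspose_eq_transpose_of_trivial, evalAt_isSymm hX hs])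
      fun v => h n X v hX
    have h2 := (hpsd.dotProduct_mulVec_zero_iff (Φ ⟨1, one_mem_degreeLE⟩)).1 (h0.trans h1).symm
    rw [hΦ ⟨p, hN⟩, LinearEquiv.map_eq_zero_iff] at h2
    have : p = 0 := congrArg Subtype.val h2
    exact ⟨0, Fin.elim0, by simp [this]⟩
  let e : Fin n → FreePoly g := fun i => (Φ.symm (Pi.single i 1) : degreeLE g N)
  have he : ∀ i j, L₀ (star (e i) * e j) = if i = j then 1 else 0 := fun i j => by
    rw [← hdot, LinearEquiv.apply_symm_apply, LinearEquiv.apply_symm_apply]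
    simp [Pi.single_apply, eq_comm]
  let Q : Matrix (Fin n) (Fin n) ℝ →ₗ[ℝ] FreePoly g :=
    { toFun := fun G => ∑ i, ∑ j, G i j • (star (e i) * e j)
      map_add' := fun G G' => by simp [add_smul, Finset.sum_add_distrib]
      map_smul' := fun c G => by simp [Finset.smul_sum, smul_smul] }
  have hQ : ∀ G, Q G = ∑ i, ∑ j, G i j • (star (e i) * e j) := fun _ => rfl
  have hQtr : ∀ G, L₀ (Q G) = G.trace := fun G => by
    simp [hQ, he, trace]
  have hQsq : ∀ G : Matrix (Fin n) (Fin n) ℝ, G.PosSemidef → IsSumSq (Q G) := fun G hG => by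
    obtain ⟨M, hM⟩ := exists_sum_star_mul_of_posSemidef hG e
    exact ⟨n, _, (hQ G).trans hM⟩
  -- Coefficients embed the polynomials in a locally convex space where Hahn–Banach applies.
  let κ : FreePoly g →ₗ[ℝ] (List (Fin g) → ℝ) := LinearMap.pi coeff
  have hκ : ∀ a b, κ a = κ b → a = b := fun a b hab => ext_coeff fun w => congrFun hab w
  set D := {G : Matrix (Fin n) (Fin n) ℝ | G.PosSemidef ∧ G.trace = 1} with hD
  have hDconv : Convex ℝ D := by
    rintro G ⟨hG, hGt⟩ G' ⟨hG', hGt'⟩ a b ha hb hab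
    exact ⟨(hG.smul ha).add (hG'.smul hb), by simp [hGt, hGt', hab]⟩
  have hcont : Continuous (κ ∘ₗ Q) := LinearMap.continuous_of_finiteDimensional _
  have hray : IsClosed ((fun s : ℝ => s • κ p) '' Set.Ici 0) :=
    isClosedMap_smul_left (κ p) _ isClosed_Ici
  have hrayconv : Convex ℝ ((fun s : ℝ => s • κ p) '' Set.Ici 0) :=
    (convex_Ici 0).linear_image (LinearMap.toSpanSingleton ℝ _ (κ p))
  -- Separating the ray through p from the compact slice L₀ = 1 of the squares avoids proving that
  -- the cone of sums of squares is closed.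
  have hdisj : Disjoint ((κ ∘ₗ Q) '' D) ((fun s : ℝ => s • κ p) '' Set.Ici 0) := by
    rw [Set.disjoint_left]
    rintro _ ⟨G, ⟨hG, hGt⟩, rfl⟩ ⟨s, hs0, hsG⟩
    have h1 : s • p = Q G := hκ _ _ (by rw [map_smul]; exact hsG)
    have h2 : s * L₀ p = 1 := by rw [← hGt, ← hQtr, ← h1, map_smul, smul_eq_mul]
    have hs1 : s ≠ 0 := by rintro rfl; simp at h2
    have hs0 : 0 ≤ s := hs0
    refine hnot ?_
    have h3 := hQsq (s⁻¹ • G) (hG.smul (by positivity))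
    rwa [map_smul, ← h1, smul_smul, inv_mul_cancel₀ hs1, one_smul] at h3
  obtain ⟨f, u, w, hfu, huw, hfw⟩ := geometric_hahn_banach_compact_closed
    (hDconv.linear_image (κ ∘ₗ Q)) ((isCompact_posSemidef_trace_one n).image hcont)
    hrayconv hray hdisj
  have hw0 : w < 0 := by simpa using hfw 0 ⟨0, by simp, by simp⟩
  have hfp : 0 ≤ f (κ p) := by
    by_contra! hneg
    have := hfw _ ⟨w / f (κ p), (div_pos_of_neg_of_neg hw0 hneg).le, rfl⟩
    rw [map_smul, smul_eq_mul, div_mul_cancel₀ _ hneg.ne] at this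
    exact lt_irrefl _ this
  -- Since f < u on the slice, L₁ is positive on nonzero squares a*a with a of degree at most N.
  -- Since u < w < 0 ≤ f(p) and L₀ p > 0, it is negative at p. Averaging with the involution keeps
  -- both properties.
  let L₁ : FreePoly g →ₗ[ℝ] ℝ := u • L₀ - (f : (List (Fin g) → ℝ) →ₗ[ℝ] ℝ) ∘ₗ κ
  have hL₁ : ∀ a, L₁ a = u * L₀ a - f (κ a) := fun _ => rfl
  let L : FreePoly g →ₗ[ℝ] ℝ := (1 / 2 : ℝ) • (L₁ + L₁ ∘ₗ starLinear g)
  have hL : ∀ a, L a = (1 / 2) * (L₁ a + L₁ (star a)) := fun _ => rfl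
  have hLpos : ∀ a ∈ degreeLE g N, a ≠ 0 → 0 < L (star a * a) := by
    intro a ha ha0
    have hLa : L (star a * a) = L₁ (star a * a) := by
      rw [hL, star_mul, star_star]; ring
    rw [hLa]
    set x := Φ ⟨a, ha⟩ with hx
    have hax : a = ∑ i, x i • e i := by
      have : (⟨a, ha⟩ : degreeLE g N) = ∑ i, x i • Φ.symm (Pi.single i 1) := by
        apply Φ.injective
        simp only [map_sum, map_smul, LinearEquiv.apply_symm_apply]
        exact pi_eq_sum_univ' _
      have := congrArg Subtype.val this
      rwa [Submodule.coe_sum] at this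
    have hxx : 0 < x ⬝ᵥ x := by rw [hx, hdot]; exact hL₀pos a ha ha0
    have hQx : Q (vecMulVec x x) = star a * a := by
      rw [hQ, hax]
      simp only [vecMulVec_apply, star_sum, star_smul_real, Finset.sum_mul_sum,
        smul_mul_smul_comm]
    have hmem : (x ⬝ᵥ x)⁻¹ • vecMulVec x x ∈ D := by
      refine ⟨PosSemidef.smul ?_ (by positivity), ?_⟩
      · simpa using posSemidef_vecMulVec_self_star x
      · rw [trace_smul, trace_vecMulVec, smul_eq_mul, inv_mul_cancel₀ hxx.ne']
    have h1 := hfu _ ⟨_, hmem, rfl⟩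
    rw [LinearMap.comp_apply, map_smul, hQx, map_smul, map_smul, smul_eq_mul,
      inv_mul_lt_iff₀ hxx] at h1
    have h2 : L₀ (star a * a) = x ⬝ᵥ x := (hdot ⟨a, ha⟩ ⟨a, ha⟩).symm
    rw [hL₁, h2]
    linarith
  have hLp : L p < 0 := by
    rw [hL, hs, hL₁]
    nlinarith
  obtain ⟨n', X', Φ', hX', hdot', hΦ'⟩ := exists_gns L
    (fun a => by rw [hL, hL, star_star, add_comm]) hLpos
  have := h n' X' (Φ' ⟨1, one_mem_degreeLE⟩) hX'
  rw [form, hΦ' ⟨p, hN⟩, hdot'] at this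
  simp only [star_one, one_mul] at this
  linarith

theorem evalAt_zero {g : ℕ} {κ : Type} [Fintype κ] [DecidableEq κ] (p : FreePoly g) :
    evalAt (fun _ => (0 : Matrix κ κ ℝ)) p = algebraMap ℝ _ (constTerm p) := by
  induction p using FreeAlgebra.induction with
  | grade0 r => simp only [AlgHom.commutes, constTerm]; rfl
  | grade1 j => simp [evalAt_ι, constTerm]
  | mul a b ha hb => simp only [map_mul, constTerm] at ha hb ⊢; rw [ha, hb]
  | add a b ha hb => simp only [map_add, constTerm] at ha hb ⊢; rw [ha, hb]

theorem Symmetric.centered {g : ℕ} {p : FreePoly g} (hp : Symmetric p) :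
    Symmetric (centered p) := by
  rw [Symmetric, FreePoly.centered, star_sub, FreeAlgebra.star_algebraMap, hp]

theorem constTerm_centered {g : ℕ} (p : FreePoly g) : constTerm (centered p) = 0 := by
  simp only [centered, constTerm, map_sub, AlgHom.commutes]
  simp

theorem centered_add {g : ℕ} (p : FreePoly g) :
    centered p + algebraMap ℝ (FreePoly g) (constTerm p) = p := by
  simp [centered]

/-! ### Excluding negative sums of squares. -/

/-- If `-p` is a sum of squares and `p` is midpoint convex without constant term, then `p = 0`. -/
theorem MidpointConvex.eq_zero_of_isSumSq_neg {g : ℕ} {p : FreePoly g} (hp : MidpointConvex p)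
    (h0 : constTerm p = 0) (hsq : IsSumSq (-p)) : -p = 0 := by
  obtain ⟨m, h, hm⟩ := hsq
  have hform : ∀ {κ : Type} [Fintype κ] [DecidableEq κ] {X : Fin g → Matrix κ κ ℝ},
      (∀ j, (X j).IsSymm) → ∀ v, -form p X v
        = ∑ k, (evalAt X (h k) *ᵥ v) ⬝ᵥ (evalAt X (h k) *ᵥ v) := fun {κ} _ _ {X} hX v => by
    rw [← vectorState_apply, ← map_neg, hm, map_sum]
    exact Finset.sum_congr rfl fun k _ => form_star_mul hX v _ _
  have hnn : ∀ {κ : Type} [Fintype κ] [DecidableEq κ] {X : Fin g → Matrix κ κ ℝ} (v : κ → ℝ),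
      ∀ k ∈ Finset.univ, 0 ≤ (evalAt X (h k) *ᵥ v) ⬝ᵥ (evalAt X (h k) *ᵥ v) :=
    fun v k _ => dotProduct_self_star_nonneg (R := ℝ) _
  have hz : ∀ k, h k = 0 := by
    intro k
    by_contra hk
    obtain ⟨N, hN⟩ := exists_mem_degreeLE (h k)
    have hF := fock_isSymm (g := g) (N := N)
    have hF' : ∀ j, (-fock g N j).IsSymm := fun j => by
      rw [Matrix.IsSymm, transpose_neg, (hF j).eq]
    -- The midpoint of F and -F is 0, where p vanishes. Both endpoint values are at most 0, so they
    -- are 0 and every square vanishes at the vacuum.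
    have hmid := hp hF hF' (vacuum g N)
    have hmz : midpt (fock g N) (fun j => -fock g N j) = fun _ => 0 := by
      ext j : 1; simp [midpt]
    rw [hmz, form, evalAt_zero, h0, map_zero, zero_mulVec, dotProduct_zero, mul_zero] at hmid
    have h1 := hform hF (vacuum g N)
    have h2 := hform hF' (vacuum g N)
    have h3 := Finset.sum_nonneg (hnn (X := fock g N) (vacuum g N))
    have h4 := Finset.sum_nonneg (hnn (X := fun j => -fock g N j) (vacuum g N))
    have h5 := (Finset.sum_eq_zero_iff_of_nonneg (hnn (X := fock g N) (vacuum g N))).1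
      (by linarith) k (Finset.mem_univ k)
    exact evalAt_fock_vacuum_ne_zero hN hk (dotProduct_self_eq_zero.1 h5)
  rw [hm]
  simp [hz]

/-! ### Matrix convexity of linear plus squares, and convex sublevel sets. -/

/-- `t p(X) + (1 - t) p(Y) - p(t X + (1 - t) Y)`, as a linear function of `p`. -/
noncomputable def convexityGap {g n : ℕ} (X Y : Fin g → Matrix (Fin n) (Fin n) ℝ) (t : ℝ) :
    FreePoly g →ₗ[ℝ] Matrix (Fin n) (Fin n) ℝ :=
  t • (evalAt X).toLinearMap + (1 - t) • (evalAt Y).toLinearMap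
    - (evalAt (t • X + (1 - t) • Y)).toLinearMap

theorem convexityGap_apply {g n : ℕ} (X Y : Fin g → Matrix (Fin n) (Fin n) ℝ) (t : ℝ)
    (p : FreePoly g) : convexityGap X Y t p
      = t • evalAt X p + (1 - t) • evalAt Y p - evalAt (t • X + (1 - t) • Y) p := rfl

theorem convexityGap_algebraMap {g n : ℕ} (X Y : Fin g → Matrix (Fin n) (Fin n) ℝ) (t c : ℝ) :
    convexityGap X Y t (algebraMap ℝ _ c) = 0 := by
  simp only [convexityGap_apply, AlgHom.commutes]
  rw [← add_smul]; simp

theorem convexityGap_isLinear {g n : ℕ} (X Y : Fin g → Matrix (Fin n) (Fin n) ℝ) (t : ℝ)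
    {l : FreePoly g} (hl : IsLinear l) : convexityGap X Y t l = 0 := by
  refine (Submodule.span_le (p := LinearMap.ker (convexityGap X Y t))).2 ?_ hl
  rintro _ ⟨j, rfl⟩
  simp [convexityGap_apply, evalAt_ι]

theorem IsLinear.symmetric {g : ℕ} {l : FreePoly g} (hl : IsLinear l) : Symmetric l := by
  induction hl using Submodule.span_induction with
  | mem x hx => obtain ⟨j, rfl⟩ := hx; simp [Symmetric]
  | zero => simp [Symmetric]
  | add x y _ _ hx hy => simp only [Symmetric, star_add] at hx hy ⊢; rw [hx, hy]
  | smul c x _ hx => simp only [Symmetric, star_smul_real] at hx ⊢; rw [hx]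

theorem convexityGap_star_mul {g n : ℕ} {X Y : Fin g → Matrix (Fin n) (Fin n) ℝ}
    (hX : ∀ j, (X j).IsSymm) (hY : ∀ j, (Y j).IsSymm) (t : ℝ) {s : FreePoly g}
    (hs : IsLinear s) : convexityGap X Y t (star s * s)
      = (t * (1 - t)) • ((evalAt X s - evalAt Y s)ᴴ * (evalAt X s - evalAt Y s)) := by
  have hZ : evalAt (t • X + (1 - t) • Y) s = t • evalAt X s + (1 - t) • evalAt Y s := by
    have := convexityGap_isLinear X Y t hs
    rw [convexityGap_apply, sub_eq_zero] at this
    exact this.symm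
  have hA := evalAt_isSymm hX hs.symmetric
  have hB := evalAt_isSymm hY hs.symmetric
  rw [convexityGap_apply, hs.symmetric, map_mul, map_mul, map_mul, hZ,
    conjTranspose_eq_transpose_of_trivial, transpose_sub, hA.eq, hB.eq]
  simp only [mul_add, add_mul, mul_sub, sub_mul, smul_mul_smul_comm]
  module

theorem matrixConvex_of_isLinearPlusSumSqLinear {g : ℕ} {p : FreePoly g} (hp : Symmetric p)
    (h : IsLinearPlusSumSqLinear (centered p)) : MatrixConvex p := by
  refine ⟨hp, fun n X Y t hX hY ht0 ht1 => ?_⟩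
  obtain ⟨l, m, s, hl, hs, hpe⟩ := h
  change (convexityGap X Y t p).PosSemidef
  rw [← centered_add p, map_add, convexityGap_algebraMap, add_zero, hpe, map_add,
    convexityGap_isLinear X Y t hl, zero_add, map_sum]
  refine posSemidef_sum _ fun k _ => ?_
  rw [convexityGap_star_mul hX hY t (hs k)]
  exact (posSemidef_conjTranspose_mul_self _).smul (mul_nonneg ht0 (by linarith))

theorem MatrixConvex.convex_sublevel {g : ℕ} {p : FreePoly g} (hp : MatrixConvex p) (n : ℕ)
    (A : Matrix (Fin n) (Fin n) ℝ) : Convex ℝ (sublevel p A) := by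
  rintro X ⟨hX, hXA⟩ Y ⟨hY, hYA⟩ a b ha hb hab
  obtain rfl : b = 1 - a := by linarith
  refine ⟨fun j => ((hX j).smul a).add ((hY j).smul (1 - a)), ?_⟩
  have hgap := hp.2 n X Y a hX hY ha (by linarith)
  have hsum : (a • (A - eval p X) + (1 - a) • (A - eval p Y)).PosDef := by
    rcases ha.eq_or_lt with rfl | ha'
    · simpa using hYA
    · exact (hXA.smul ha').add_posSemidef (hYA.posSemidef.smul hb)
  convert hsum.add_posSemidef hgap using 1
  module

theorem sublevel_centered {g n : ℕ} (p : FreePoly g) (A : Matrix (Fin n) (Fin n) ℝ) :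
    sublevel (centered p) A = sublevel p (A + constTerm p • 1) := by
  have : ∀ X : Fin g → Matrix (Fin n) (Fin n) ℝ,
      A - eval (centered p) X = A + constTerm p • 1 - eval p X := fun X => by
    rw [eval_eq_evalAt, eval_eq_evalAt, centered, map_sub, AlgHom.commutes,
      Algebra.algebraMap_eq_smul_one]
    abel
  simp only [sublevel, this]

end FreePoly

/-! ### The equivalence. -/

open FreePoly in
theorem theorem1p2 (g : ℕ) (p : FreePoly g) (hp : FreePoly.Symmetric p) :
    List.TFAE [
      FreePoly.IsLinearPlusSumSqLinear (FreePoly.centered p),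
      FreePoly.MatrixConvex p,
      ∀ (n : ℕ) (A : Matrix (Fin n) (Fin n) ℝ), A.IsSymm → Convex ℝ (FreePoly.sublevel p A),
      FreePoly.QuasiConvex (FreePoly.centered p) ∧
        ¬ (-FreePoly.centered p ≠ 0 ∧ FreePoly.IsSumSq (-FreePoly.centered p))] := by
  tfae_have 1 → 2 := matrixConvex_of_isLinearPlusSumSqLinear hp
  tfae_have 2 → 3 := fun h n A _ => h.convex_sublevel n A
  tfae_have 3 → 4 := fun h => by
    have hc : ∀ (n : ℕ) (A : Matrix (Fin n) (Fin n) ℝ), A.IsSymm →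
        Convex ℝ (sublevel (centered p) A) := fun n A hA => by
      rw [sublevel_centered]
      exact h n _ (hA.add (Matrix.isSymm_one.smul _))
    refine ⟨⟨hp.centered, constTerm_centered p, fun n A hA => hc n A ?_⟩, fun hsq => hsq.1 ?_⟩
    · rw [Matrix.IsSymm, ← conjTranspose_eq_transpose_of_trivial, hA.1.eq]
    · have hmid : MidpointConvex (centered p) := midpointConvex_of_sublevel hp.centered hc
      exact hmid.eq_zero_of_isSumSq_neg (constTerm_centered p) hsq.2
  tfae_have 4 → 1 := fun ⟨hq, hns⟩ => by
    -- A positive value gives access to all levels and hence midpoint convexity; without one,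
    -- Helton's theorem applies to the negative.
    by_cases hpos : ∃ (n : ℕ) (X : Fin g → Matrix (Fin n) (Fin n) ℝ) (v : Fin n → ℝ),
        (∀ j, (X j).IsSymm) ∧ 0 < form (centered p) X v
    · obtain ⟨n, X, v, hX, hv⟩ := hpos
      have hmid : MidpointConvex (centered p) := hq.midpointConvex hX hv
      exact hmid.isLinearPlusSumSqLinear hp.centered (constTerm_centered p)
    · push Not at hpos
      have hsq : FreePoly.IsSumSq (-centered p) := by
        refine isSumSq_of_form_nonneg ?_ fun n X v hX => ?_
        · rw [FreePoly.Symmetric, star_neg, hp.centered]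
        · have := hpos n X v hX
          rw [← vectorState_apply, map_neg, vectorState_apply]
          linarith
      have h0 : centered p = 0 := by
        by_contra hne
        exact hns ⟨neg_ne_zero.2 hne, hsq⟩
      exact ⟨0, 0, Fin.elim0, Submodule.zero_mem _, fun j => j.elim0, by simp [h0]⟩
  tfae_finish
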